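/- Let $\mathcal V=(Q,n,\delta)$ be a VASS: $Q$ is a nonempty finite set of control states, $n\ge 1$, and $\delta\subseteq Q\times\mathbb Z^n\times Q$ is finite. Let $(q,\mathbf x)\in Q\times\mathbb N^n$ be a configuration and $i\in\{1,\dots,n\}$. A finite run is a nonempty finite sequence of configurations in which each configuration $(p,\mathbf y)$ is followed by some $(p',\mathbf y+\mathbf b)$ with $(p,\mathbf b,p')\in\delta$ and $\mathbf y+\mathbf b\in\mathbb N^n$. The auxiliary VASS $\mathcal V_{rb}$ has dimension $2n$ and control states $Q\times\{\mathrm{DEC},\mathrm{INC}\}^n$. It has a transition $(p,\mathbf m)\xrightarrow{\mathbf b'}(p',\mathbf m')$ iff there is $(p,\mathbf b,p')\in\delta$ such that for every $j\in\{1,\dots,n\}$: $\mathbf b'(j)=\mathbf b(j)$; if $\mathbf b(j)<0$ then $\mathbf m'(j)=\mathrm{DEC}$; if $\mathbf b(j)>0$ then $\mathbf m'(j)=\mathrm{INC}$; if $\mathbf b(j)=0$ then $\mathbf m'(j)=\mathbf m(j)$; and $\mathbf b'(n+j)=1$ if $\mathbf m'(j)\ne\mathbf m(j)$ (a reversal),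 $\mathbf b'(n+j)=0$ otherwise. For $B\in\mathbb N$, the directed graph $TS_B$ on the configurations of $\mathcal V_{rb}$ is defined as the transition system of $\mathcal V_{rb}$, except that a reversal of component $j$ increments component $n+j$ only if the value of component $j$ just before the transition is greater than $B$ (and leaves component $n+j$ unchanged otherwise). Put $q_{rb}=(q,(\mathrm{INC},\dots,\mathrm{INC}))$ and $\mathbf x_{rb}=(\mathbf x,\mathbf 0)\in\mathbb N^{2n}$. The initialized VASS $(\mathcal V,(q,\mathbf x))$ is *weakly reversal-bounded with respect to $i$* if there is $B\ge 0$ such that the set of values $\mathbf y(n+i)$, over all $(q',\mathbf y)$ reachable from $(q_{rb},\mathbf x_{rb})$ in $TS_B$, is finite. A *disjointness sequence* (in dimension $2n$) is a nonempty sequence $\sigma=X_1\cdots X_K$ of nonempty, pairwise disjoint subsets of $\{1,\dots,2n\}$. A finite run satisfies $\mathrm{PB}_\sigma$ if it can be decomposed as $$(q_0,\mathbf x_0)\xrightarrow{*}(q_1,\mathbf x_1)\xrightarrow{*}(q_2,\mathbf x_2)\xrightarrow{*}\cdots\xrightarrow{*}(q_{2K-1},\mathbf x_{2K-1})\xrightarrow{*}(q_{2K},\mathbf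 x_{2K})$$ so that for every $l\in\{1,\dots,K\}$: $q_{2l-1}=q_{2l}$; $\mathbf x_{2l-1}(j)<\mathbf x_{2l}(j)$ for all $j\in X_l$; and for all $j\notin X_l$, $\mathbf x_{2l}(j)<\mathbf x_{2l-1}(j)$ implies $j\in X_1\cup\cdots\cup X_{l-1}$. **Lemma.** $(\mathcal V,(q,\mathbf x))$ is not weakly reversal-bounded with respect to $i$ if and only if there are a disjointness sequence $\sigma=X_1\cdots X_K$ with $n+i\in X_K$ and $i\in X_1\cup\cdots\cup X_{K-1}$ and a finite run of $\mathcal V_{rb}$ starting at $(q_{rb},\mathbf x_{rb})$ that satisfies $\mathrm{PB}_\sigma$. -/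

import Mathlib

/-- A vector addition system with states: a nonempty finite set `Q` of control states, a dimension
`n ≥ 1`, and a finite set of transitions `(q, b, q')` with `b ∈ ℤⁿ`. -/
structure VASS (Q : Type*) (n : ℕ) where
  states_finite : Finite Q
  states_nonempty : Nonempty Q
  one_le_dim : 1 ≤ n
  trans : Set (Q × (Fin n → ℤ) × Q)
  trans_finite : trans.Finite

namespace VASS

/-- Configurations: a control state and a vector of natural numbers. -/
abbrev Config (Q : Type*) (n : ℕ) := Q × (Fin n → ℕ)

/-- The one-step relation on configurations. -/
def Step {Q : Type*} {n : ℕ} (V : VASS Q n) (c c' : Config Q n) : Prop :=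
  ∃ b : Fin n → ℤ, (c.1, b, c'.1) ∈ V.trans ∧ ∀ j, (c'.2 j : ℤ) = (c.2 j : ℤ) + b j

/-- `ρ 0, …, ρ L` is a finite run. -/
def IsRun {Q : Type*} {n : ℕ} (V : VASS Q n) {L : ℕ} (ρ : Fin (L + 1) → Config Q n) : Prop :=
  ∀ k : Fin L, V.Step (ρ k.castSucc) (ρ k.succ)

/-- A disjointness sequence: a nonempty sequence of nonempty, pairwise disjoint sets of
components. -/
structure IsDisjointnessSeq {n K : ℕ} (σ : Fin K → Set (Fin n)) : Prop where
  length_pos : 0 < K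
  nonempty : ∀ l, (σ l).Nonempty
  disjoint : ∀ l l', l ≠ l' → Disjoint (σ l) (σ l')

/-- The position `2l - 1` of the start of the `l`-th distinguished segment, where `l ∈ [1, K]` is
represented by `l - 1 : Fin K`. -/
def startIdx {K : ℕ} (l : Fin K) : Fin (2 * K + 1) := ⟨2 * l.val + 1, by omega⟩

/-- The position `2l` of the end of the `l`-th distinguished segment. -/
def stopIdx {K : ℕ} (l : Fin K) : Fin (2 * K + 1) := ⟨2 * l.val + 2, by omega⟩

/-- The sequence of configurations `ρ` satisfies `PB_σ`: it can be cut at positions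
`0 = p 0 ≤ p 1 ≤ ⋯ ≤ p (2K) = L` in such a way that the configurations
`(q_k, x_k) = ρ (p k)` satisfy (P0), (STRICT) and (NONSTRICT). -/
def SatisfiesPB {Q : Type*} {n K L : ℕ} (σ : Fin K → Set (Fin n))
    (ρ : Fin (L + 1) → Config Q n) : Prop :=
  ∃ p : Fin (2 * K + 1) → Fin (L + 1),
    Monotone p ∧ p 0 = 0 ∧ p (Fin.last (2 * K)) = Fin.last L ∧
    (∀ l : Fin K, (ρ (p (startIdx l))).1 = (ρ (p (stopIdx l))).1) ∧
    (∀ l : Fin K, ∀ j ∈ σ l, (ρ (p (startIdx l))).2 j < (ρ (p (stopIdx l))).2 j) ∧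
    (∀ l : Fin K, ∀ j ∉ σ l, (ρ (p (stopIdx l))).2 j < (ρ (p (startIdx l))).2 j →
      ∃ l' < l, j ∈ σ l')

/-- The two modes of a counter. -/
inductive Mode where
  | DEC
  | INC

/-- The initial configuration `(q_rb, x_rb)`: all modes are `INC`, the first `n` components are
`x` and the last `n` components are `0`. -/
def rbInit {Q : Type*} {n : ℕ} (c : Config Q n) : Config (Q × (Fin n → Mode)) (n + n) :=
  ((c.1, fun _ => Mode.INC), Fin.append c.2 (fun _ => 0))

/-- How one transition with effect `b` on a counter updates its mode from `m` to `m'`, with `c` the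
effect on its reversal counter. -/
def RevCond (b : ℤ) (m m' : Mode) (c : ℤ) : Prop :=
  (b < 0 ∧ m = Mode.DEC ∧ m' = Mode.DEC ∧ c = 0) ∨
  (b < 0 ∧ m = Mode.INC ∧ m' = Mode.DEC ∧ c = 1) ∨
  (b > 0 ∧ m = Mode.INC ∧ m' = Mode.INC ∧ c = 0) ∨
  (b > 0 ∧ m = Mode.DEC ∧ m' = Mode.INC ∧ c = 1) ∨
  (b = 0 ∧ m = m' ∧ c = 0)

/-- The same update when a reversal is counted only if the current value `x` of the counter is
above `B`. -/
def WeakRevCond (B x : ℕ) (b : ℤ) (m m' : Mode) (c : ℤ) : Prop :=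
  (b < 0 ∧ m = Mode.DEC ∧ m' = Mode.DEC ∧ c = 0) ∨
  (b < 0 ∧ m = Mode.INC ∧ m' = Mode.DEC ∧ x ≤ B ∧ c = 0) ∨
  (b < 0 ∧ m = Mode.INC ∧ m' = Mode.DEC ∧ x > B ∧ c = 1) ∨
  (b > 0 ∧ m = Mode.INC ∧ m' = Mode.INC ∧ c = 0) ∨
  (b > 0 ∧ m = Mode.DEC ∧ m' = Mode.INC ∧ x > B ∧ c = 1) ∨
  (b > 0 ∧ m = Mode.DEC ∧ m' = Mode.INC ∧ x ≤ B ∧ c = 0) ∨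
  (b = 0 ∧ m = m' ∧ c = 0)

/-- The transitions of `V_rb`. Component `i` of `V` is component `Fin.castAdd n i` of `V_rb`, and
`Fin.natAdd n i` is the component `n + i`, which counts the reversals of `i`. -/
def rbTrans {Q : Type*} {n : ℕ} (V : VASS Q n) :
    Set ((Q × (Fin n → Mode)) × (Fin (n + n) → ℤ) × (Q × (Fin n → Mode))) :=
  {t | ∃ b : Fin n → ℤ, (t.1.1, b, t.2.2.1) ∈ V.trans ∧
    (∀ j, t.2.1 (Fin.castAdd n j) = b j) ∧
    ∀ j, RevCond (b j) (t.1.2 j) (t.2.2.2 j) (t.2.1 (Fin.natAdd n j))}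

theorem finite_mode : Finite Mode :=
  Finite.of_surjective (fun b : Bool => if b then Mode.INC else Mode.DEC) (by
    intro m
    cases m with
    | DEC => exact ⟨false, rfl⟩
    | INC => exact ⟨true, rfl⟩)

theorem rbTrans_finite {Q : Type*} {n : ℕ} (V : VASS Q n) : V.rbTrans.Finite := by
  have := finite_mode
  have hfin : (V.trans ×ˢ
      (Set.univ : Set ((Fin n → Mode) × (Fin n → Mode) × (Fin n → Bool)))).Finite :=
    V.trans_finite.prod Set.finite_univ
  refine (hfin.image (fun s => ((s.1.1, s.2.1),
    (Fin.append s.1.2.1 (fun j => if s.2.2.2 j then (1 : ℤ) else 0)),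
    (s.1.2.2, s.2.2.1)))).subset ?_
  rintro ⟨⟨q, m⟩, b', ⟨q', m'⟩⟩ ⟨b, hb, h1, h2⟩
  refine ⟨((q, b, q'), (m, m', fun j => decide (b' (Fin.natAdd n j) = 1))),
    ⟨hb, Set.mem_univ _⟩, ?_⟩
  simp only [Prod.mk.injEq, and_true, true_and]
  funext k
  refine Fin.addCases (fun j => ?_) (fun j => ?_) k
  · rw [Fin.append_left]
    exact (h1 j).symm
  · have h := h2 j
    simp only [RevCond] at h
    have h01 : b' (Fin.natAdd n j) = 0 ∨ b' (Fin.natAdd n j) = 1 := by tauto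
    rw [Fin.append_right]
    rcases h01 with h0 | h0 <;> simp only [h0] <;> decide

/-- The auxiliary VASS `V_rb` of dimension `2n`, with control states `Q × {DEC, INC}ⁿ`. -/
def rb {Q : Type*} {n : ℕ} (V : VASS Q n) : VASS (Q × (Fin n → Mode)) (n + n) where
  states_finite := by
    have := finite_mode
    have := V.states_finite
    infer_instance
  states_nonempty := by
    obtain ⟨q⟩ := V.states_nonempty
    exact ⟨(q, fun _ => Mode.INC)⟩
  one_le_dim := le_trans V.one_le_dim (Nat.le_add_left n n)
  trans := V.rbTrans
  trans_finite := V.rbTrans_finite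

/-- The one-step relation of the infinite directed graph `TS_B`. -/
def TSStep {Q : Type*} {n : ℕ} (V : VASS Q n) (B : ℕ)
    (c c' : Config (Q × (Fin n → Mode)) (n + n)) : Prop :=
  ∃ b' : Fin (n + n) → ℤ, ∃ b : Fin n → ℤ, (c.1.1, b, c'.1.1) ∈ V.trans ∧
    (∀ j, b' (Fin.castAdd n j) = b j) ∧
    (∀ j, WeakRevCond B (c.2 (Fin.castAdd n j)) (b j) (c.1.2 j) (c'.1.2 j)
      (b' (Fin.natAdd n j))) ∧
    ∀ k, (c'.2 k : ℤ) = (c.2 k : ℤ) + b' k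

/-- `(V, c)` is weakly reversal-bounded with respect to the component `i`: for some `B`, the
component `n + i` takes finitely many values on the vertices of `TS_B` that are reachable from
`(q_rb, x_rb)`. -/
def WeaklyReversalBoundedWrt {Q : Type*} {n : ℕ} (V : VASS Q n) (c : Config Q n)
    (i : Fin n) : Prop :=
  ∃ B : ℕ, {m : ℕ | ∃ d : Config (Q × (Fin n → Mode)) (n + n),
    Relation.ReflTransGen (V.TSStep B) (rbInit c) d ∧ d.2 (Fin.natAdd n i) = m}.Finite

end VASS

/-! Suppose that weak reversal-boundedness fails. Then for every `N` some run of `V` with modes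
reverses `i` at least `N` times at values above `N` (`Rich`). Fix a nonprincipal ultrafilter on
these `N`. Branching is finite, so one first step serves shortest witnesses for almost every `N`.
Repeating this choice (`Viable.exists_progress`) yields an infinite path on which each step shortens
the remaining witness for almost every `N`, or counts a reversal. The latter forces `i` to be
frozen, since a fixed value of `i` is not above almost every `N`.

By Dickson's lemma the path has a nondecreasing loop (`Rich.exists_loop`). If it counts no reversal,
it cannot return to the same configuration, because the remaining length has dropped; hence it
increases some component. As in the Karp–Miller construction, the increased components are then
frozen, i.e. treated as infinite, and the argument restarts; this happens at most `n` times.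
Eventually `i` is frozen and the loop contains a reversal of `i`. `Accelerated.exists_chain` turns
the recorded loops into the segments of a real run, and the last loop becomes the segment for `{n +
i}`.

Conversely, pumping the earlier loops of a run satisfying `PB_σ` makes `i`, and every component that
the last loop may decrease, as large as desired (`IsChain.exists_pumped`). The last loop contains a
reversal of `i`, so for any `B` it can be repeated any number of times with that reversal above `B`
(`exists_counted_iterate`). -/

namespace VASS

open Filter Relation

/-! ### Extraction of loops by an ultrafilter argument, with frozen components. -/

section Frozen

variable {P : Type*} {n : ℕ}

/-- The one-step relation in which the components in `S` are left unchanged and do not have to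
stay nonnegative. -/
def FrozenStep (W : VASS P n) (S : Set (Fin n)) (c c' : Config P n) : Prop :=
  ∃ b : Fin n → ℤ, (c.1, b, c'.1) ∈ W.trans ∧ (∀ j ∉ S, (c'.2 j : ℤ) = (c.2 j : ℤ) + b j) ∧
    ∀ j ∈ S, c'.2 j = c.2 j

open Classical in
/-- Reset the components in `S` to zero. -/
noncomputable def freeze (S : Set (Fin n)) (c : Config P n) : Config P n :=
  (c.1, fun j => if j ∈ S then 0 else c.2 j)

@[simp] theorem freeze_fst (S : Set (Fin n)) (c : Config P n) : (freeze S c).1 = c.1 := rfl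

theorem freeze_of_mem {S : Set (Fin n)} {j : Fin n} (hj : j ∈ S) (c : Config P n) :
    (freeze S c).2 j = 0 := by simp [freeze, hj]

theorem freeze_of_notMem {S : Set (Fin n)} {j : Fin n} (hj : j ∉ S) (c : Config P n) :
    (freeze S c).2 j = c.2 j := by simp [freeze, hj]

variable {W : VASS P n} {S S' : Set (Fin n)}

theorem FrozenStep.mono {c c' : Config P n} (hS : S ⊆ S') (h : W.FrozenStep S c c') :
    W.FrozenStep S' (freeze S' c) (freeze S' c') := by
  obtain ⟨b, hb, h1, -⟩ := h
  refine ⟨b, hb, fun j hj => ?_, fun j hj => ?_⟩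
  · rw [freeze_of_notMem hj, freeze_of_notMem hj]
    exact h1 j fun h => hj (hS h)
  · rw [freeze_of_mem hj, freeze_of_mem hj]

theorem Step.freeze {c c' : Config P n} (h : W.Step c c') (S : Set (Fin n)) :
    W.FrozenStep S (freeze S c) (VASS.freeze S c') := by
  obtain ⟨b, hb, h1⟩ := h
  exact FrozenStep.mono (Set.empty_subset S) ⟨b, hb, fun j _ => h1 j, by simp⟩

/-- Finite branching is what lets the ultrafilter select a single successor. -/
theorem finite_setOf_frozenStep (W : VASS P n) (S : Set (Fin n)) (c : Config P n) :
    {c' | W.FrozenStep S c c'}.Finite := by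
  classical
  refine (W.trans_finite.image fun t =>
    (t.2.2, fun j => if j ∈ S then c.2 j else ((c.2 j : ℤ) + t.2.1 j).toNat)).subset ?_
  rintro ⟨p, y⟩ ⟨b, hb, h1, h2⟩
  refine ⟨_, hb, ?_⟩
  simp only [Prod.mk.injEq, true_and]
  funext j
  by_cases hj : j ∈ S
  · simpa [hj] using (h2 j hj).symm
  · have := h1 j hj
    simp only [hj, if_false]
    simp only at this
    omega

/-- `W.MarkedRun R i S B L m c`: some run of length `L` from `c`, with the components in `S`
frozen, has at least `m` steps that are marked by `R` and that start with a value of `i` above `B`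
or take place while `i` is frozen. -/
inductive MarkedRun (W : VASS P n) (R : P → P → Prop) (i : Fin n) (S : Set (Fin n)) (B : ℕ) :
    ℕ → ℕ → Config P n → Prop
  | nil (c) : MarkedRun W R i S B 0 0 c
  | skip {L m c c'} : W.FrozenStep S c c' → MarkedRun W R i S B L m c' →
      MarkedRun W R i S B (L + 1) m c
  | mark {L m c c'} : W.FrozenStep S c c' → R c.1 c'.1 → (i ∈ S ∨ B < c.2 i) →
      MarkedRun W R i S B L m c' → MarkedRun W R i S B (L + 1) (m + 1) c

variable {R : P → P → Prop} {i : Fin n}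

theorem MarkedRun.mono {B B' L m m' : ℕ} {c : Config P n} (h : W.MarkedRun R i S B L m c)
    (hB : B' ≤ B) (hm : m' ≤ m) : W.MarkedRun R i S B' L m' c := by
  induction h generalizing m' with
  | nil c =>
    obtain rfl : m' = 0 := by omega
    exact .nil c
  | skip h _ ih => exact .skip h (ih hm)
  | mark h hR hi _ ih =>
    cases m' with
    | zero => exact .skip h (ih (Nat.zero_le _))
    | succ m' => exact .mark h hR (hi.imp_right fun h => by omega) (ih (by omega))

theorem MarkedRun.freeze {B L m : ℕ} {c : Config P n} (h : W.MarkedRun R i S B L m c)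
    (hS : S ⊆ S') : W.MarkedRun R i S' B L m (freeze S' c) := by
  induction h with
  | nil c => exact .nil _
  | skip h _ ih => exact .skip (h.mono hS) ih
  | @mark L m c c' h hR hi _ ih =>
    refine .mark (h.mono hS) hR ?_ ih
    by_cases hi' : i ∈ S'
    · exact .inl hi'
    · rw [freeze_of_notMem hi']
      exact .inr (hi.resolve_left fun h => hi' (hS h))

/-- The least length of a run with at least `m` counted marks. -/
noncomputable def minLength (W : VASS P n) (R : P → P → Prop) (i : Fin n) (S : Set (Fin n))
    (B m : ℕ) (c : Config P n) : ℕ :=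
  sInf {L | W.MarkedRun R i S B L m c}

/-- Take the first step of a shortest witness: if it is not counted as a mark, the rest of the
witness is shorter and has the same number of marks. -/
theorem exists_step_minLength_lt {B m : ℕ} {c : Config P n}
    (h : ∃ L, W.MarkedRun R i S B L (m + 1) c) :
    ∃ c', W.FrozenStep S c c' ∧ (((∃ L, W.MarkedRun R i S B L (m + 1) c') ∧
        W.minLength R i S B (m + 1) c' < W.minLength R i S B (m + 1) c) ∨
      (R c.1 c'.1 ∧ (i ∈ S ∨ B < c.2 i) ∧ ∃ L, W.MarkedRun R i S B L m c')) := by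
  have hmin : W.MarkedRun R i S B (W.minLength R i S B (m + 1) c) (m + 1) c := Nat.sInf_mem h
  generalize W.minLength R i S B (m + 1) c = L at hmin
  cases hmin with
  | @skip L m c c' h hr =>
    refine ⟨c', h, .inl ⟨⟨L, hr⟩, ?_⟩⟩
    exact Nat.lt_succ_of_le (Nat.sInf_le hr)
  | @mark L m c c' h hR hi hr => exact ⟨c', h, .inr ⟨hR, hi, L, hr⟩⟩

/-- For every `N` there is a run from `c` with at least `N` marks counted above `N`. -/
def Rich (W : VASS P n) (R : P → P → Prop) (i : Fin n) (S : Set (Fin n)) (c : Config P n) : Prop :=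
  ∀ N, ∃ L, W.MarkedRun R i S N L N c

/-- Almost every `N` admits a run from `s.1` with at least `N - s.2` marks counted above `N`. -/
def Viable (W : VASS P n) (R : P → P → Prop) (i : Fin n) (S : Set (Fin n))
    (s : Config P n × ℕ) : Prop :=
  ∀ᶠ N in (hyperfilter ℕ : Filter ℕ), ∃ L, W.MarkedRun R i S N L (N - s.2) s.1

theorem eventually_hyperfilter_ge (k : ℕ) : ∀ᶠ N in (hyperfilter ℕ : Filter ℕ), k ≤ N :=
  Nat.hyperfilter_le_atTop (eventually_ge_atTop k)

theorem Viable.rich {s : Config P n × ℕ} (h : W.Viable R i S s) : W.Rich R i S s.1 := by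
  intro M
  obtain ⟨N, ⟨L, hN⟩, hM⟩ := (h.and (eventually_hyperfilter_ge (M + s.2))).exists
  exact ⟨L, hN.mono (by omega) (by omega)⟩

theorem Rich.viable {c : Config P n} (h : W.Rich R i S c) : W.Viable R i S (c, 0) :=
  Eventually.of_forall fun N => h N

theorem Rich.freeze {c : Config P n} (h : W.Rich R i S c) (hS : S ⊆ S') :
    W.Rich R i S' (freeze S' c) := fun N =>
  let ⟨L, hL⟩ := h N
  ⟨L, hL.freeze hS⟩

/-- A step along which the minimal remaining length decreases for almost all `N`, unless a mark
is counted while `i` is frozen. -/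
def Progress (W : VASS P n) (R : P → P → Prop) (i : Fin n) (S : Set (Fin n))
    (s s' : Config P n × ℕ) : Prop :=
  W.FrozenStep S s.1 s'.1 ∧
    ((s'.2 = s.2 ∧ ∀ᶠ N in (hyperfilter ℕ : Filter ℕ),
        W.minLength R i S N (N - s'.2) s'.1 < W.minLength R i S N (N - s.2) s.1) ∨
      (s.2 < s'.2 ∧ i ∈ S ∧ R s.1.1 s'.1.1))

/-- The first step of a shortest witness depends on `N`, but it has finitely many possible targets
and is of one of two kinds; the ultrafilter makes both choices uniform in `N`. -/
theorem Viable.exists_progress {s : Config P n × ℕ} (h : W.Viable R i S s) :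
    ∃ s', W.Viable R i S s' ∧ W.Progress R i S s s' := by
  obtain ⟨c, k⟩ := s
  have h1 : ∀ᶠ N in (hyperfilter ℕ : Filter ℕ), ∃ c' ∈ {c' | W.FrozenStep S c c'},
      (((∃ L, W.MarkedRun R i S N L (N - k) c') ∧
        W.minLength R i S N (N - k) c' < W.minLength R i S N (N - k) c) ∨
      (R c.1 c'.1 ∧ (i ∈ S ∨ N < c.2 i) ∧ ∃ L, W.MarkedRun R i S N L (N - (k + 1)) c')) := by
    filter_upwards [h, eventually_hyperfilter_ge (k + 1)] with N hN hk
    obtain ⟨m, hm⟩ : ∃ m, N - k = m + 1 := ⟨N - k - 1, by omega⟩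
    have hm' : N - (k + 1) = m := by omega
    simp only [hm, hm'] at hN ⊢
    exact exists_step_minLength_lt hN
  rw [Ultrafilter.eventually_exists_mem_iff (W.finite_setOf_frozenStep S c)] at h1
  obtain ⟨c', hc', h2⟩ := h1
  rcases Ultrafilter.eventually_or.1 h2 with h2 | h2
  · exact ⟨(c', k), h2.mono fun N h => h.1, hc', .inl ⟨rfl, h2.mono fun N h => h.2⟩⟩
  · refine ⟨(c', k + 1), h2.mono fun N h => h.2.2, hc', .inr ⟨Nat.lt_succ_self k, ?_⟩⟩
    -- For `N ≥ c.2 i` the mark cannot be counted by `N < c.2 i`, so `i` must be frozen.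
    obtain ⟨N, hN, hle⟩ := (h2.and (eventually_hyperfilter_ge (c.2 i))).exists
    exact ⟨hN.2.1.resolve_right (by omega), hN.1⟩

theorem exists_lt_le_of_finite [Finite P] (f : ℕ → Config P n) :
    ∃ a b, a < b ∧ (f a).1 = (f b).1 ∧ (f a).2 ≤ (f b).2 :=
  ((Finite.wellQuasiOrdered (α := P) (· = ·)).prod
    (wellQuasiOrdered_le (α := Fin n → ℕ))) f

/-- Either no mark is counted between two positions of a progressing sequence, or the segment
between them contains a marked step with `i` frozen. -/
theorem progress_segment {s : ℕ → Config P n × ℕ}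
    (hs : ∀ k, W.Progress R i S (s k) (s (k + 1))) (a d : ℕ) :
    ReflTransGen (W.FrozenStep S) (s a).1 (s (a + d)).1 ∧
    (((s (a + d)).2 = (s a).2 ∧ (d = 0 ∨ ∀ᶠ N in (hyperfilter ℕ : Filter ℕ),
        W.minLength R i S N (N - (s (a + d)).2) (s (a + d)).1 <
          W.minLength R i S N (N - (s a).2) (s a).1)) ∨
      (i ∈ S ∧ ∃ u v, ReflTransGen (W.FrozenStep S) (s a).1 u ∧ W.FrozenStep S u v ∧ R u.1 v.1 ∧
        ReflTransGen (W.FrozenStep S) v (s (a + d)).1)) := by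
  induction d with
  | zero => exact ⟨.refl, .inl ⟨rfl, .inl rfl⟩⟩
  | succ d ih =>
    obtain ⟨hr, h⟩ := ih
    obtain ⟨hstep, hp⟩ := hs (a + d)
    rw [← Nat.add_assoc]
    refine ⟨hr.tail hstep, ?_⟩
    rcases h with ⟨he, h⟩ | ⟨hi, u, v, h1, h2, h3, h4⟩
    · rcases hp with ⟨he', hp⟩ | ⟨-, hi, hR⟩
      · refine .inl ⟨he'.trans he, .inr ?_⟩
        rcases h with rfl | h
        · exact hp
        · filter_upwards [h, hp] with N h h' using h'.trans h
      · exact .inr ⟨hi, _, _, hr, hstep, hR, .refl⟩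
    · exact .inr ⟨hi, u, v, h1, h2, h3, h4.tail hstep⟩

/-- From a rich configuration one either reaches a loop that strictly increases a component that
is not frozen and ends in a rich configuration, or `i` is frozen and one reaches a nondecreasing
loop with a marked step. -/
theorem Rich.exists_loop {c : Config P n} (h : W.Rich R i S c) :
    (∃ a b, ReflTransGen (W.FrozenStep S) c a ∧ ReflTransGen (W.FrozenStep S) a b ∧
      a.1 = b.1 ∧ a.2 ≤ b.2 ∧ a.2 ≠ b.2 ∧ W.Rich R i S b) ∨
    (i ∈ S ∧ ∃ a u v b, ReflTransGen (W.FrozenStep S) c a ∧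
      ReflTransGen (W.FrozenStep S) a u ∧ W.FrozenStep S u v ∧ R u.1 v.1 ∧
      ReflTransGen (W.FrozenStep S) v b ∧ a.1 = b.1 ∧ a.2 ≤ b.2) := by
  have := W.states_finite
  choose f hf using fun s : {s // W.Viable R i S s} => s.2.exists_progress
  let g : ℕ → {s // W.Viable R i S s} := fun k =>
    Nat.rec ⟨(c, 0), h.viable⟩ (fun _ s => ⟨f s, (hf s).1⟩) k
  have hg : ∀ k, W.Progress R i S (g k).1 (g (k + 1)).1 := fun k => (hf (g k)).2
  obtain ⟨a, b, hab, hst, hle⟩ := exists_lt_le_of_finite fun k => (g k).1.1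
  obtain ⟨d, rfl⟩ := Nat.exists_eq_add_of_lt hab
  have hca := (progress_segment hg 0 a).1
  rw [Nat.zero_add] at hca
  obtain ⟨hr, ⟨he, hd⟩ | ⟨hi, u, v, h1, h2, h3, h4⟩⟩ := progress_segment hg a (d + 1)
  · refine .inl ⟨_, _, hca, hr, hst, hle, fun heq => ?_, (g (a + d + 1)).2.rich⟩
    have hd := hd.resolve_left (Nat.succ_ne_zero d)
    -- If nothing increased, configuration and mark count coincide at both ends, so a minimal length
    -- would be smaller than itself.
    have heq' : (g a).1.1 = (g (a + d + 1)).1.1 := Prod.ext hst heq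
    have hd' : (g a).1 = (g (a + (d + 1))).1 := Prod.ext heq' he.symm
    rw [hd'] at hd
    obtain ⟨N, hN⟩ := hd.exists
    exact lt_irrefl _ hN
  · exact .inr ⟨hi, _, u, v, _, hca, h1, h2, h3, h4, hst, hle⟩

/-- Configurations reached by a sequence of runs that end with a nondecreasing loop; from then on
the components that the loop increases are frozen. -/
inductive Accelerated (W : VASS P n) (c₀ : Config P n) : Set (Fin n) → Config P n → Prop
  | init : Accelerated W c₀ ∅ c₀
  | loop {S c a b} : Accelerated W c₀ S c → ReflTransGen (W.FrozenStep S) c a →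
      ReflTransGen (W.FrozenStep S) a b → a.1 = b.1 → a.2 ≤ b.2 → a.2 ≠ b.2 →
      Accelerated W c₀ (S ∪ {j | a.2 j < b.2 j}) (freeze (S ∪ {j | a.2 j < b.2 j}) b)

theorem frozen_eq_of_reach {c c' : Config P n} (h : ReflTransGen (W.FrozenStep S) c c')
    {j : Fin n} (hj : j ∈ S) : c'.2 j = c.2 j := by
  induction h with
  | refl => rfl
  | tail _ h ih =>
    obtain ⟨_, _, _, h⟩ := h
    rw [h j hj, ih]

/-- Each strictly increasing loop freezes at least one new component, and richness survives
freezing, so induction on the number of unfrozen components reaches the loop with a mark. -/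
theorem Rich.exists_accelerated_loop {c₀ c : Config P n} (h : W.Rich R i S c)
    (hc : W.Accelerated c₀ S c) :
    ∃ S c, W.Accelerated c₀ S c ∧ i ∈ S ∧ ∃ a u v b, ReflTransGen (W.FrozenStep S) c a ∧
      ReflTransGen (W.FrozenStep S) a u ∧ W.FrozenStep S u v ∧ R u.1 v.1 ∧
      ReflTransGen (W.FrozenStep S) v b ∧ a.1 = b.1 ∧ a.2 ≤ b.2 := by
  induction hm : Sᶜ.ncard using Nat.strong_induction_on generalizing S c with
  | _ m ih =>
    rcases h.exists_loop with ⟨a, b, h1, h2, h3, h4, h5, h6⟩ | ⟨hi, hex⟩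
    · have hlt : (S ∪ {j | a.2 j < b.2 j})ᶜ.ncard < m := by
        rw [← hm]
        refine Set.ncard_lt_ncard (compl_lt_compl_iff_lt.2 ?_) (Set.toFinite _)
        refine Set.ssubset_iff_subset_ne.2 ⟨Set.subset_union_left, fun heq => h5 ?_⟩
        funext j
        refine le_antisymm (h4 j) (not_lt.1 fun hj => ?_)
        have hjS : j ∈ S := heq ▸ Set.mem_union_right S hj
        exact absurd (frozen_eq_of_reach h2 hjS) hj.ne'
      exact ih _ hlt (h6.freeze Set.subset_union_left) (hc.loop h1 h2 h3 h4 h5) rfl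
    · exact ⟨S, c, hc, hi, hex⟩

end Frozen

end VASS
namespace VASS

open Relation

/-! ### Realizing frozen runs from configurations that are large on the frozen components. -/

section Lifting

variable {P : Type*} {n : ℕ} {W : VASS P n} {S : Set (Fin n)}

/-- `z` has the same state as `c`, is above `c` outside `S` and above `T` on `S`. -/
def Above (S : Set (Fin n)) (T : ℕ) (c z : Config P n) : Prop :=
  z.1 = c.1 ∧ (∀ j ∉ S, c.2 j ≤ z.2 j) ∧ ∀ j ∈ S, T ≤ z.2 j

theorem Above.mono {T T' : ℕ} {c c' z : Config P n} (h : Above S T c z) (hT : T' ≤ T)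
    (hst : c'.1 = c.1) (hle : c'.2 ≤ c.2) : Above S T' c' z :=
  ⟨h.1.trans hst.symm, fun j hj => (hle j).trans (h.2.1 j hj), fun j hj => hT.trans (h.2.2 j hj)⟩

theorem FrozenStep.exists_lift {c c' : Config P n} (h : W.FrozenStep S c c') (T : ℕ) :
    ∃ T', ∀ z, Above S T' c z → ∃ z', W.Step z z' ∧ Above S T c' z' ∧
      ∀ j ∉ S, z'.2 j + c.2 j = z.2 j + c'.2 j := by
  obtain ⟨b, hb, h1, -⟩ := h
  -- The sum bounds the loss of any component in this step.
  refine ⟨T + ∑ j, (b j).natAbs, fun z ⟨hz, hz1, hz2⟩ => ?_⟩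
  have hbig : ∀ j ∈ S, (T : ℤ) ≤ (z.2 j : ℤ) + b j := fun j hj => by
    have h := hz2 j hj
    have h' : (b j).natAbs ≤ ∑ j, (b j).natAbs :=
      Finset.single_le_sum (f := fun j => (b j).natAbs) (fun _ _ => Nat.zero_le _)
        (Finset.mem_univ j)
    omega
  have hz' : ∀ j, ((((z.2 j : ℤ) + b j).toNat : ℕ) : ℤ) = (z.2 j : ℤ) + b j := fun j => by
    by_cases hj : j ∈ S
    · have := hbig j hj
      omega
    · have := h1 j hj
      have := hz1 j hj
      omega
  refine ⟨(c'.1, fun j => ((z.2 j : ℤ) + b j).toNat), ⟨b, hz ▸ hb, hz'⟩,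
    ⟨rfl, fun j hj => ?_, fun j hj => ?_⟩, fun j hj => ?_⟩
  · have := h1 j hj
    have := hz1 j hj
    simp only
    omega
  · have := hbig j hj
    simp only
    omega
  · have := h1 j hj
    have := hz' j
    simp only
    omega

theorem exists_lift_reach {c c' : Config P n} (h : ReflTransGen (W.FrozenStep S) c c') (T : ℕ) :
    ∃ T', ∀ z, Above S T' c z → ∃ z', ReflTransGen W.Step z z' ∧ Above S T c' z' ∧
      ∀ j ∉ S, z'.2 j + c.2 j = z.2 j + c'.2 j := by
  induction h generalizing T with
  | refl => exact ⟨T, fun z hz => ⟨z, .refl, hz, fun _ _ => rfl⟩⟩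
  | tail _ h ih =>
    obtain ⟨T₁, h1⟩ := h.exists_lift T
    obtain ⟨T₂, h2⟩ := ih T₁
    refine ⟨T₂, fun z hz => ?_⟩
    obtain ⟨y, hy, hy', hys⟩ := h2 z hz
    obtain ⟨w, hw, hw', hws⟩ := h1 y hy'
    refine ⟨w, hy.tail hw, hw', fun j hj => ?_⟩
    have := hys j hj
    have := hws j hj
    omega

/-- The end of a nondecreasing loop dominates its start outside `S`, so the loop can be repeated
once the components in `S` are large enough for all repetitions. -/
theorem exists_lift_iterate {a b : Config P n} (h : ReflTransGen (W.FrozenStep S) a b)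
    (hst : a.1 = b.1) (hle : a.2 ≤ b.2) (m T : ℕ) :
    ∃ T', ∀ z, Above S T' a z → ∃ z', ReflTransGen W.Step z z' ∧ Above S T a z' ∧
      ∀ j ∉ S, z'.2 j + m * a.2 j = z.2 j + m * b.2 j := by
  induction m with
  | zero => exact ⟨T, fun z hz => ⟨z, .refl, hz, fun _ _ => by simp⟩⟩
  | succ m ih =>
    obtain ⟨T₁, h1⟩ := ih
    obtain ⟨T₂, h2⟩ := exists_lift_reach h T₁
    refine ⟨T₂, fun z hz => ?_⟩
    obtain ⟨y, hy, hy', hys⟩ := h2 z hz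
    obtain ⟨w, hw, hw', hws⟩ := h1 y (hy'.mono le_rfl hst hle)
    refine ⟨w, hy.trans hw, hw', fun j hj => ?_⟩
    have := hys j hj
    have := hws j hj
    rw [Nat.succ_mul, Nat.succ_mul]
    omega

end Lifting

/-! ### Chains of loops and their translation into runs satisfying `PB_σ`. -/

section Chain

variable {P : Type*} {n : ℕ} {W : VASS P n}

/-- The configurations `d 0, …, d (2K)` are the cut points of a run from `c₀` that satisfies
`PB` with respect to `X 0, …, X (K - 1)`. -/
structure IsChain (W : VASS P n) (c₀ : Config P n) (K : ℕ) (X : ℕ → Set (Fin n))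
    (d : ℕ → Config P n) : Prop where
  zero : d 0 = c₀
  reach : ∀ k < 2 * K, ReflTransGen W.Step (d k) (d (k + 1))
  state : ∀ l < K, (d (2 * l + 1)).1 = (d (2 * l + 2)).1
  strict : ∀ l < K, ∀ j ∈ X l, (d (2 * l + 1)).2 j < (d (2 * l + 2)).2 j
  nonstrict : ∀ l < K, ∀ j ∉ X l, (d (2 * l + 2)).2 j < (d (2 * l + 1)).2 j →
    ∃ l' < l, j ∈ X l'

theorem IsChain.snoc {c₀ : Config P n} {K : ℕ} {X : ℕ → Set (Fin n)} {d : ℕ → Config P n}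
    (h : W.IsChain c₀ K X d) {a b : Config P n} {Y : Set (Fin n)}
    (ha : ReflTransGen W.Step (d (2 * K)) a) (hb : ReflTransGen W.Step a b) (hst : a.1 = b.1)
    (hY : ∀ j ∈ Y, a.2 j < b.2 j) (hY' : ∀ j ∉ Y, b.2 j < a.2 j → ∃ l < K, j ∈ X l) :
    ∃ X' d', W.IsChain c₀ (K + 1) X' d' ∧ (∀ l < K, X' l = X l) ∧ X' K = Y ∧
      d' (2 * (K + 1)) = b := by
  obtain ⟨X', hX'⟩ : ∃ X' : ℕ → Set (Fin n), X' = fun l => if l < K then X l else Y := ⟨_, rfl⟩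
  obtain ⟨d', hd'⟩ : ∃ d' : ℕ → Config P n,
    d' = fun k => if k ≤ 2 * K then d k else if k = 2 * K + 1 then a else b := ⟨_, rfl⟩
  have hXl : ∀ l < K, X' l = X l := fun l hl => by simp [hX', hl]
  have hXK : X' K = Y := by simp [hX']
  have hdk : ∀ k ≤ 2 * K, d' k = d k := fun k hk => by simp [hd', hk]
  have hda : d' (2 * K + 1) = a := by simp [hd']
  have hdb : d' (2 * K + 2) = b := by simp [hd']
  have key : ∀ l < K + 1, (l < K ∧ X' l = X l ∧ d' (2 * l + 1) = d (2 * l + 1) ∧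
      d' (2 * l + 2) = d (2 * l + 2)) ∨ l = K := fun l hl => by
    rcases Nat.lt_succ_iff_lt_or_eq.1 hl with hl | hl
    · exact .inl ⟨hl, hXl l hl, hdk _ (by omega), hdk _ (by omega)⟩
    · exact .inr hl
  refine ⟨X', d', ⟨(hdk 0 (Nat.zero_le _)).trans h.zero, fun k hk => ?_, fun l hl => ?_,
    fun l hl => ?_, fun l hl => ?_⟩, hXl, hXK, hdb⟩
  · rcases lt_trichotomy k (2 * K) with hk' | rfl | hk'
    · rw [hdk k hk'.le, hdk (k + 1) hk']
      exact h.reach k hk'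
    · rwa [hda, hdk _ le_rfl]
    · obtain rfl : k = 2 * K + 1 := by omega
      rwa [hda, hdb]
  · rcases key l hl with ⟨hl, -, e1, e2⟩ | rfl
    · rw [e1, e2]
      exact h.state l hl
    · rwa [hda, hdb]
  · rcases key l hl with ⟨hl, e, e1, e2⟩ | rfl
    · rw [e, e1, e2]
      exact h.strict l hl
    · rwa [hda, hdb, hXK]
  · rcases key l hl with ⟨hl, e, e1, e2⟩ | rfl
    · rw [e, e1, e2]
      intro j hj hlt
      obtain ⟨l', hl', hj'⟩ := h.nonstrict l hl j hj hlt
      exact ⟨l', hl', by rwa [hXl l' (hl'.trans hl)]⟩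
    · rw [hda, hdb, hXK]
      intro j hj hlt
      obtain ⟨l', hl', hj'⟩ := hY' j hj hlt
      exact ⟨l', hl', by rwa [hXl l' hl']⟩

/-- Accelerated configurations are realized by chains, with arbitrarily large values of the
frozen components. -/
theorem Accelerated.exists_chain {c₀ c : Config P n} {S : Set (Fin n)}
    (h : W.Accelerated c₀ S c) (T : ℕ) :
    ∃ K X d, W.IsChain c₀ K X d ∧ (∀ l < K, (X l).Nonempty) ∧
      (∀ l < K, ∀ l' < l, Disjoint (X l') (X l)) ∧ (∀ j, j ∈ S ↔ ∃ l < K, j ∈ X l) ∧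
      Above S T c (d (2 * K)) ∧ ∀ j ∉ S, (d (2 * K)).2 j = c.2 j := by
  induction h generalizing T with
  | init =>
    refine ⟨0, fun _ => ∅, fun _ => c₀, ⟨rfl, ?_, ?_, ?_, ?_⟩, ?_, ?_, ?_, ⟨rfl, ?_, ?_⟩, ?_⟩ <;>
      simp
  | @loop S c a b _ hca hab hst hle hne ih =>
    -- Thresholds are chosen backwards. The loop is run `T` times to bring the increased components
    -- up to `T`, then once more as the new segment of the chain.
    obtain ⟨T₁, h1⟩ := exists_lift_reach hab T
    obtain ⟨T₂, h2⟩ := exists_lift_iterate hab hst hle T T₁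
    obtain ⟨T₃, h3⟩ := exists_lift_reach hca T₂
    obtain ⟨K, X, d, hd, hX, hX', hS, hz, hzS⟩ := ih T₃
    obtain ⟨z₁, r1, m1, s1⟩ := h3 _ hz
    obtain ⟨z₂, r2, m2, s2⟩ := h2 _ m1
    obtain ⟨z₃, r3, m3, s3⟩ := h1 _ m2
    have hinc : ∀ j, a.2 j < b.2 j → j ∉ S := fun j hj hjS =>
      absurd (frozen_eq_of_reach hab hjS) hj.ne'
    obtain ⟨X', d', hd', e1, e2, e3⟩ := hd.snoc (Y := {j | a.2 j < b.2 j}) (r1.trans r2) r3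
      (m2.1.trans (hst.trans m3.1.symm)) (fun j hj => by
        have := s3 j (hinc j hj)
        have : a.2 j < b.2 j := hj
        omega) (fun j hj hlt => by
        rw [← hS]
        by_contra hjS
        have := s3 j hjS
        have : a.2 j ≤ b.2 j := hle j
        omega)
    have hz₂ : ∀ j ∉ S, z₂.2 j + T * a.2 j = a.2 j + T * b.2 j := fun j hj => by
      have := s1 j hj
      have := hzS j hj
      have := s2 j hj
      omega
    have hend : ∀ j ∉ S ∪ {j | a.2 j < b.2 j}, z₃.2 j = b.2 j := fun j hj => by
      simp only [Set.mem_union, Set.mem_ofPred_eq, not_or, not_lt] at hj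
      have := s3 j hj.1
      have h := hz₂ j hj.1
      rw [le_antisymm (hle j) hj.2] at *
      omega
    refine ⟨K + 1, X', d', hd', fun l hl => ?_, fun l hl l' hl' => ?_, fun j => ?_, ?_, ?_⟩
    · rcases Nat.lt_succ_iff_lt_or_eq.1 hl with hl | rfl
      · rw [e1 l hl]
        exact hX l hl
      · rw [e2]
        by_contra hemp
        refine hne (funext fun j => le_antisymm (hle j) (not_lt.1 fun hj => hemp ⟨j, hj⟩))
    · rcases Nat.lt_succ_iff_lt_or_eq.1 hl with hl | rfl
      · rw [e1 l hl, e1 l' (hl'.trans hl)]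
        exact hX' l hl l' hl'
      · rw [e2, e1 l' hl']
        exact Set.disjoint_left.2 fun j hj hj' => hinc j hj' ((hS j).2 ⟨l', hl', hj⟩)
    · constructor
      · rintro (hj | hj)
        · obtain ⟨l, hl, hj⟩ := (hS j).1 hj
          exact ⟨l, Nat.lt_succ_of_lt hl, by rwa [e1 l hl]⟩
        · exact ⟨K, Nat.lt_succ_self K, by rwa [e2]⟩
      · rintro ⟨l, hl, hj⟩
        rcases Nat.lt_succ_iff_lt_or_eq.1 hl with hl | rfl
        · exact .inl ((hS j).2 ⟨l, hl, by rwa [← e1 l hl]⟩)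
        · exact .inr (by rwa [← e2])
    · rw [e3]
      refine ⟨m3.1, fun j hj => ?_, fun j hj => ?_⟩
      · rw [freeze_of_notMem hj, hend j hj]
      · by_cases hjS : j ∈ S
        · exact m3.2.2 j hjS
        · have hlt : a.2 j < b.2 j := hj.resolve_left hjS
          have := s3 j hjS
          have := hz₂ j hjS
          have : T * a.2 j + T ≤ T * b.2 j := by
            rw [← Nat.mul_succ]
            exact Nat.mul_le_mul_left T hlt
          omega
    · intro j hj
      rw [e3, freeze_of_notMem hj, hend j hj]

theorem exists_seq_of_reflTransGen {α : Type*} {r : α → α → Prop} {x y : α}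
    (h : ReflTransGen r x y) :
    ∃ (L : ℕ) (ρ : ℕ → α), ρ 0 = x ∧ ρ L = y ∧ ∀ k < L, r (ρ k) (ρ (k + 1)) := by
  induction h using ReflTransGen.head_induction_on with
  | refl => exact ⟨0, fun _ => y, rfl, rfl, by simp⟩
  | @head x z hxz _ ih =>
    obtain ⟨L, ρ, h0, hL, hρ⟩ := ih
    refine ⟨L + 1, fun k => Nat.casesOn k x ρ, rfl, hL, fun k hk => ?_⟩
    cases k with
    | zero => simpa [h0] using hxz
    | succ k => exact hρ k (by omega)

theorem exists_seq_through {α : Type*} {r : α → α → Prop} (M : ℕ) (d : ℕ → α)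
    (h : ∀ k < M, ReflTransGen r (d k) (d (k + 1))) :
    ∃ (ρ : ℕ → α) (p : ℕ → ℕ), Monotone p ∧ p 0 = 0 ∧ (∀ k ≤ M, ρ (p k) = d k) ∧
      ∀ k < p M, r (ρ k) (ρ (k + 1)) := by
  induction M with
  | zero => exact ⟨fun _ => d 0, fun _ => 0, monotone_const, rfl, by simp, by simp⟩
  | succ M ih =>
    obtain ⟨ρ, p, hp, hp0, hρ, hr⟩ := ih fun k hk => h k (Nat.lt_succ_of_lt hk)
    obtain ⟨L, τ, hτ0, hτL, hτ⟩ := exists_seq_of_reflTransGen (h M (Nat.lt_succ_self M))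
    have hM := hρ M le_rfl
    refine ⟨fun k => if k ≤ p M then ρ k else τ (k - p M), fun k => if k ≤ M then p k else p M + L,
      ?_, by simp [hp0], fun k hk => ?_, fun k hk => ?_⟩
    · intro a b hab
      simp only
      split_ifs with h1 h2 h2
      · exact hp hab
      · exact (hp h1).trans (Nat.le_add_right _ _)
      · omega
      · exact le_rfl
    · rcases Nat.le_succ_iff.1 hk with hk | rfl
      · simp [hk, hp hk, hρ k hk]
      · rcases Nat.eq_zero_or_pos L with rfl | hL
        · simp [hM, ← hτ0, hτL]
        · simp [hτL, hL.ne']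
    · simp only [Nat.not_succ_le_self, if_false] at hk
      rcases lt_trichotomy k (p M) with hk' | rfl | hk'
      · simp only [hk'.le, if_true, Nat.succ_le_of_lt hk']
        exact hr k hk'
      · simp only [le_rfl, if_true, Nat.not_succ_le_self, if_false, Nat.add_sub_cancel_left]
        rw [hM, ← hτ0]
        exact hτ 0 (by omega)
      · simp only [hk'.not_ge, if_false, (Nat.lt_succ_of_lt hk').not_ge]
        rw [Nat.succ_sub hk'.le]
        exact hτ _ (by omega)

theorem IsRun.reach {L : ℕ} {ρ : Fin (L + 1) → Config P n} (h : W.IsRun ρ) {a b : Fin (L + 1)}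
    (hab : a ≤ b) : ReflTransGen W.Step (ρ a) (ρ b) := by
  induction b using Fin.induction with
  | zero => rw [Fin.le_zero_iff.1 hab]
  | succ b ih =>
    rcases hab.lt_or_eq with hlt | rfl
    · exact (ih (Fin.le_castSucc_iff.2 hlt)).tail (h b)
    · exact .refl

/-- This trades finite index types for reachability between consecutive cut points indexed by `ℕ`,
which is easier to extend and to pump. -/
theorem exists_run_satisfiesPB_iff (c₀ : Config P n) (K : ℕ) (X : ℕ → Set (Fin n)) :
    (∃ (L : ℕ) (ρ : Fin (L + 1) → Config P n), ρ 0 = c₀ ∧ W.IsRun ρ ∧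
      SatisfiesPB (fun l : Fin K => X l) ρ) ↔ ∃ d, W.IsChain c₀ K X d := by
  constructor
  · rintro ⟨L, ρ, h0, hρ, p, hp, hp0, -, h1, h2, h3⟩
    -- Indices beyond the last cut point are clamped to it.
    let e : ℕ → Fin (2 * K + 1) := fun k => ⟨min k (2 * K), by omega⟩
    have he1 : ∀ (l : ℕ) (hl : l < K), e (2 * l + 1) = startIdx ⟨l, hl⟩ := fun l hl =>
      Fin.ext (min_eq_left (by omega))
    have he2 : ∀ (l : ℕ) (hl : l < K), e (2 * l + 2) = stopIdx ⟨l, hl⟩ := fun l hl =>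
      Fin.ext (min_eq_left (by omega))
    refine ⟨fun k => ρ (p (e k)), ⟨?_, fun k _ => hρ.reach (hp ?_), fun l hl => ?_, fun l hl => ?_,
      fun l hl => ?_⟩⟩
    · have : e 0 = 0 := Fin.ext (Nat.zero_min _)
      simp only [this, hp0, h0]
    · exact min_le_min_right _ (Nat.le_succ k)
    · simp only [he1 l hl, he2 l hl]
      exact h1 ⟨l, hl⟩
    · simp only [he1 l hl, he2 l hl]
      exact h2 ⟨l, hl⟩
    · simp only [he1 l hl, he2 l hl]
      intro j hj hlt
      obtain ⟨l', hl', hj'⟩ := h3 ⟨l, hl⟩ j hj hlt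
      exact ⟨l', hl', hj'⟩
  · rintro ⟨d, hd⟩
    obtain ⟨ρ, p, hp, hp0, hρ, hr⟩ := exists_seq_through (2 * K) d hd.reach
    refine ⟨p (2 * K), fun k => ρ k, ?_, fun k => hr k k.2, fun k => ⟨p k, ?_⟩, fun a b hab => ?_,
      ?_, ?_, fun l => ?_, fun l j hj => ?_, fun l j hj hlt => ?_⟩
    · have := hρ 0 (Nat.zero_le _)
      rw [hp0] at this
      exact this.trans hd.zero
    · exact Nat.lt_succ_of_le (hp (Nat.lt_succ_iff.1 k.2))
    · exact hp hab
    · exact Fin.ext hp0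
    · rfl
    · simp only [startIdx, stopIdx]
      rw [hρ _ (by omega), hρ _ (by omega)]
      exact hd.state l l.2
    · simp only [startIdx, stopIdx]
      rw [hρ _ (by omega), hρ _ (by omega)]
      exact hd.strict l l.2 j hj
    · simp only [startIdx, stopIdx] at hlt
      rw [hρ _ (by omega), hρ _ (by omega)] at hlt
      obtain ⟨l', hl', hj'⟩ := hd.nonstrict l l.2 j hj hlt
      exact ⟨⟨l', hl'.trans l.2⟩, hl', hj'⟩

end Chain

end VASS
namespace VASS

open Relation

/-! ### Reversal counters as passive observers of the VASS with modes. -/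

section Modes

variable {Q : Type*} {n : ℕ}

/-- How a transition with effect `b` on a counter updates its mode. -/
def ModeUpdate (b : ℤ) (m m' : Mode) : Prop :=
  (b < 0 → m' = Mode.DEC) ∧ (0 < b → m' = Mode.INC) ∧ (b = 0 → m' = m)

theorem revCond_iff (b : ℤ) (m m' : Mode) (c : ℤ) :
    RevCond b m m' c ↔ ModeUpdate b m m' ∧ (m ≠ m' → c = 1) ∧ (m = m' → c = 0) := by
  rcases lt_trichotomy b 0 with hb | rfl | hb <;> cases m <;> cases m' <;>
    simp [RevCond, ModeUpdate, *, ne_of_lt, ne_of_gt, lt_asymm]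

theorem weakRevCond_iff (B x : ℕ) (b : ℤ) (m m' : Mode) (c : ℤ) :
    WeakRevCond B x b m m' c ↔ ModeUpdate b m m' ∧ (m ≠ m' ∧ B < x → c = 1) ∧
      (¬ (m ≠ m' ∧ B < x) → c = 0) := by
  rcases lt_trichotomy b 0 with hb | rfl | hb <;> rcases le_or_gt x B with hx | hx <;>
    cases m <;> cases m' <;>
    simp [WeakRevCond, ModeUpdate, *, ne_of_lt, ne_of_gt, lt_asymm, not_lt_of_ge, not_le_of_gt]

/-- The VASS `V` with the modes of the counters added to its control states. -/
def moded (V : VASS Q n) : VASS (Q × (Fin n → Mode)) n where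
  states_finite := V.rb.states_finite
  states_nonempty := V.rb.states_nonempty
  one_le_dim := V.one_le_dim
  trans := {t | (t.1.1, t.2.1, t.2.2.1) ∈ V.trans ∧
    ∀ j, ModeUpdate (t.2.1 j) (t.1.2 j) (t.2.2.2 j)}
  trans_finite := by
    have := finite_mode
    refine ((V.trans_finite.prod (Set.finite_univ (α := (Fin n → Mode) × (Fin n → Mode)))).image
      fun s => ((s.1.1, s.2.1), s.1.2.1, (s.1.2.2, s.2.2))).subset ?_
    rintro ⟨⟨q, m⟩, b, q', m'⟩ ⟨h, -⟩
    exact ⟨((q, b, q'), (m, m')), ⟨h, Set.mem_univ _⟩, rfl⟩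

/-- Forget the reversal counters. -/
def proj (d : Config (Q × (Fin n → Mode)) (n + n)) : Config (Q × (Fin n → Mode)) n :=
  (d.1, fun j => d.2 (Fin.castAdd n j))

open Classical in
/-- A step of `V` with modes in which a reversal of a counter is counted when the value of the
counter satisfies `θ`. -/
def CountStep (V : VASS Q n) (θ : ℕ → Prop) (c c' : Config (Q × (Fin n → Mode)) (n + n)) : Prop :=
  V.moded.Step (proj c) (proj c') ∧ ∀ j, c'.2 (Fin.natAdd n j) = c.2 (Fin.natAdd n j) +
    if c.1.2 j ≠ c'.1.2 j ∧ θ (c.2 (Fin.castAdd n j)) then 1 else 0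

variable {V : VASS Q n} {θ : ℕ → Prop} {i : Fin n}

/-- Together with `tsStep_eq_countStep`, this makes `V_rb` and `TS_B` two instances of one relation,
so runs transfer between them through the projection. -/
theorem rb_step_eq_countStep (V : VASS Q n) : V.rb.Step = V.CountStep fun _ => True := by
  classical
  funext c c'
  refine propext ⟨?_, ?_⟩
  · rintro ⟨b', ⟨b, hb, h1, h2⟩, h3⟩
    simp only at hb h1 h2
    simp only [revCond_iff] at h2
    refine ⟨⟨b, ⟨hb, fun j => (h2 j).1⟩, fun j => ?_⟩, fun j => ?_⟩
    · rw [← h1]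
      exact h3 _
    · have := h3 (Fin.natAdd n j)
      split_ifs with h
      · rw [(h2 j).2.1 h.1] at this
        omega
      · rw [(h2 j).2.2 (not_not.1 fun h' => h ⟨h', trivial⟩)] at this
        omega
  · rintro ⟨⟨b, ⟨hb, hm⟩, h1⟩, h2⟩
    refine ⟨Fin.append b fun j => if c.1.2 j ≠ c'.1.2 j then 1 else 0,
      ⟨b, hb, fun j => by simp, fun j => ?_⟩, fun k => ?_⟩
    · simp only [Fin.append_right, revCond_iff]
      exact ⟨hm j, fun h => by simp [h], fun h => by simp [h]⟩
    · refine Fin.addCases (fun j => ?_) (fun j => ?_) k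
      · rw [Fin.append_left]
        exact h1 j
      · rw [Fin.append_right, h2 j]
        simp

theorem tsStep_eq_countStep (V : VASS Q n) (B : ℕ) : V.TSStep B = V.CountStep fun x => B < x := by
  classical
  funext c c'
  refine propext ⟨?_, ?_⟩
  · rintro ⟨b', b, hb, h1, h2, h3⟩
    simp only [weakRevCond_iff] at h2
    refine ⟨⟨b, ⟨hb, fun j => (h2 j).1⟩, fun j => ?_⟩, fun j => ?_⟩
    · rw [← h1]
      exact h3 _
    · have := h3 (Fin.natAdd n j)
      split_ifs with h
      · rw [(h2 j).2.1 h] at this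
        omega
      · rw [(h2 j).2.2 h] at this
        omega
  · rintro ⟨⟨b, ⟨hb, hm⟩, h1⟩, h2⟩
    refine ⟨Fin.append b fun j =>
      if c.1.2 j ≠ c'.1.2 j ∧ B < c.2 (Fin.castAdd n j) then 1 else 0,
      b, hb, fun j => Fin.append_left _ _ _, fun j => ?_, fun k => ?_⟩
    · rw [Fin.append_right, weakRevCond_iff]
      exact ⟨hm j, fun h => if_pos h, fun h => if_neg h⟩
    · refine Fin.addCases (fun j => ?_) (fun j => ?_) k
      · rw [Fin.append_left]
        exact h1 j
      · rw [Fin.append_right, h2 j]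
        push_cast
        rfl

theorem CountStep.counter_le {c c' : Config (Q × (Fin n → Mode)) (n + n)}
    (h : V.CountStep θ c c') (j : Fin n) : c.2 (Fin.natAdd n j) ≤ c'.2 (Fin.natAdd n j) := by
  rw [h.2 j]
  exact Nat.le_add_right _ _

theorem CountStep.counter_lt {c c' : Config (Q × (Fin n → Mode)) (n + n)}
    (h : V.CountStep θ c c') {j : Fin n} (hj : c.1.2 j ≠ c'.1.2 j)
    (hθ : θ (c.2 (Fin.castAdd n j))) : c.2 (Fin.natAdd n j) < c'.2 (Fin.natAdd n j) := by
  rw [h.2 j, if_pos ⟨hj, hθ⟩]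
  exact Nat.lt_succ_self _

theorem counter_le_of_reach {c c' : Config (Q × (Fin n → Mode)) (n + n)}
    (h : ReflTransGen (V.CountStep θ) c c') (j : Fin n) :
    c.2 (Fin.natAdd n j) ≤ c'.2 (Fin.natAdd n j) := by
  induction h with
  | refl => exact le_rfl
  | tail _ h ih => exact ih.trans (h.counter_le j)

theorem reach_proj {c c' : Config (Q × (Fin n → Mode)) (n + n)}
    (h : ReflTransGen (V.CountStep θ) c c') :
    ReflTransGen V.moded.Step (proj c) (proj c') :=
  h.lift proj fun _ _ h => h.1

theorem Step.exists_countStep {c : Config (Q × (Fin n → Mode)) (n + n)}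
    {y : Config (Q × (Fin n → Mode)) n} (h : V.moded.Step (proj c) y) (θ : ℕ → Prop) :
    ∃ c', V.CountStep θ c c' ∧ proj c' = y := by
  classical
  have hp : proj (y.1, Fin.append y.2 fun j => c.2 (Fin.natAdd n j) +
      if c.1.2 j ≠ y.1.2 j ∧ θ (c.2 (Fin.castAdd n j)) then 1 else 0) = y :=
    Prod.ext rfl (funext fun j => by simp [proj])
  exact ⟨_, ⟨hp.symm ▸ h, fun j => by simp only [Fin.append_right]⟩, hp⟩

/-- Reversal counters only grow and never block a step, so every run of the moded VASS lifts,
whatever the counting condition. -/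
theorem exists_reach_countStep {c : Config (Q × (Fin n → Mode)) (n + n)}
    {y : Config (Q × (Fin n → Mode)) n} (h : ReflTransGen V.moded.Step (proj c) y)
    (θ : ℕ → Prop) : ∃ c', ReflTransGen (V.CountStep θ) c c' ∧ proj c' = y := by
  induction h with
  | refl => exact ⟨c, .refl, rfl⟩
  | tail _ h ih =>
    obtain ⟨c', h', rfl⟩ := ih
    obtain ⟨c'', h'', rfl⟩ := h.exists_countStep θ
    exact ⟨c'', h'.tail h'', rfl⟩

theorem exists_markedRun_of_reach {B : ℕ} {c d : Config (Q × (Fin n → Mode)) (n + n)}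
    (h : ReflTransGen (V.CountStep fun x => B < x) c d) (i : Fin n) :
    ∃ L m, V.moded.MarkedRun (fun s t => s.2 i ≠ t.2 i) i ∅ B L m (proj c) ∧
      d.2 (Fin.natAdd n i) = c.2 (Fin.natAdd n i) + m := by
  induction h using ReflTransGen.head_induction_on with
  | refl => exact ⟨0, 0, .nil _, rfl⟩
  | head hstep _ ih =>
    obtain ⟨L, m, hL, hm⟩ := ih
    obtain ⟨⟨b, hb, h1⟩, h2⟩ := hstep
    have hF : V.moded.FrozenStep ∅ (proj _) (proj _) := ⟨b, hb, fun j _ => h1 j, by simp⟩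
    rw [h2 i] at hm
    split_ifs at hm with h
    · exact ⟨L + 1, m + 1, .mark hF h.1 (.inr h.2) hL, by omega⟩
    · exact ⟨L + 1, m, .skip hF hL, by omega⟩

theorem exists_mark_of_counter_lt {c d : Config (Q × (Fin n → Mode)) (n + n)}
    (h : ReflTransGen (V.CountStep θ) c d) (hlt : c.2 (Fin.natAdd n i) < d.2 (Fin.natAdd n i)) :
    ∃ u v, ReflTransGen V.moded.Step (proj c) u ∧ V.moded.Step u v ∧ u.1.2 i ≠ v.1.2 i ∧
      ReflTransGen V.moded.Step v (proj d) := by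
  induction h with
  | refl => exact absurd hlt (lt_irrefl _)
  | @tail y z hcy hyz ih =>
    by_cases hy : c.2 (Fin.natAdd n i) < y.2 (Fin.natAdd n i)
    · obtain ⟨u, v, h1, h2, h3, h4⟩ := ih hy
      exact ⟨u, v, h1, h2, h3, h4.tail hyz.1⟩
    · refine ⟨_, _, reach_proj hcy, hyz.1, fun he => hy ?_, .refl⟩
      have h2 := hyz.2 i
      rw [if_neg fun h => h.1 he] at h2
      omega

theorem exists_lift_seq (c₀ : Config (Q × (Fin n → Mode)) (n + n)) (M : ℕ)
    (d : ℕ → Config (Q × (Fin n → Mode)) n) (h0 : d 0 = proj c₀)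
    (h : ∀ k < M, ReflTransGen V.moded.Step (d k) (d (k + 1))) (θ : ℕ → Prop) :
    ∃ e : ℕ → Config (Q × (Fin n → Mode)) (n + n), e 0 = c₀ ∧ (∀ k ≤ M, proj (e k) = d k) ∧
      ∀ k < M, ReflTransGen (V.CountStep θ) (e k) (e (k + 1)) := by
  induction M with
  | zero => exact ⟨fun _ => c₀, rfl, fun k hk => by rw [Nat.le_zero.1 hk, h0], by simp⟩
  | succ M ih =>
    obtain ⟨e, he0, he, hr⟩ := ih fun k hk => h k (Nat.lt_succ_of_lt hk)
    obtain ⟨c, hc, hc'⟩ := exists_reach_countStep (V := V) (c := e M) (y := d (M + 1))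
      (by rw [he M le_rfl]; exact h M (Nat.lt_succ_self M)) θ
    have hne : ∀ k ≤ M, Function.update e (M + 1) c k = e k := fun k hk =>
      Function.update_of_ne (by omega) _ _
    refine ⟨Function.update e (M + 1) c, ?_, fun k hk => ?_, fun k hk => ?_⟩
    · rw [hne 0 (Nat.zero_le _), he0]
    · rcases Nat.le_succ_iff.1 hk with hk | rfl
      · rw [hne k hk, he k hk]
      · rw [Function.update_self, hc']
    · rcases Nat.lt_succ_iff_lt_or_eq.1 hk with hk | rfl
      · rw [hne k hk.le, hne (k + 1) hk]
        exact hr k hk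
      · rwa [hne k le_rfl, Function.update_self]

/-- The added components are nondecreasing, so they satisfy the nonstrict condition without
belonging to any set of the chain. -/
theorem IsChain.exists_lift {c₀ : Config (Q × (Fin n → Mode)) (n + n)} {K : ℕ}
    {X : ℕ → Set (Fin n)} {d : ℕ → Config (Q × (Fin n → Mode)) n}
    (h : V.moded.IsChain (proj c₀) K X d) :
    ∃ e, V.rb.IsChain c₀ K (fun l => Fin.castAdd n '' X l) e ∧ proj (e (2 * K)) = d (2 * K) := by
  obtain ⟨e, he0, he, hr⟩ := exists_lift_seq c₀ (2 * K) d h.zero h.reach fun _ => True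
  have hst : ∀ k ≤ 2 * K, (e k).1 = (d k).1 := fun k hk => congrArg Prod.fst (he k hk)
  have hval : ∀ k ≤ 2 * K, ∀ j, (e k).2 (Fin.castAdd n j) = (d k).2 j := fun k hk j =>
    congrFun (congrArg Prod.snd (he k hk)) j
  refine ⟨e, ⟨he0, fun k hk => V.rb_step_eq_countStep ▸ hr k hk, fun l hl => ?_, fun l hl => ?_,
    fun l hl => ?_⟩, he _ le_rfl⟩
  · rw [hst _ (by omega), hst _ (by omega), h.state l hl]
  · rintro _ ⟨j, hj, rfl⟩
    rw [hval _ (by omega), hval _ (by omega)]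
    exact h.strict l hl j hj
  · intro k
    refine Fin.addCases (fun j => ?_) (fun j => ?_) k
    · intro hj hlt
      rw [hval _ (by omega), hval _ (by omega)] at hlt
      obtain ⟨l', hl', hj'⟩ := h.nonstrict l hl j (fun hj' => hj ⟨j, hj', rfl⟩) hlt
      exact ⟨l', hl', j, hj', rfl⟩
    · intro _ hlt
      exact absurd (counter_le_of_reach (hr _ (by omega)) j) hlt.not_ge

theorem IsChain.proj {c₀ : Config (Q × (Fin n → Mode)) (n + n)} {K : ℕ}
    {X : ℕ → Set (Fin (n + n))} {d : ℕ → Config (Q × (Fin n → Mode)) (n + n)}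
    (h : V.rb.IsChain c₀ K X d) :
    V.moded.IsChain (proj c₀) K (fun l => Fin.castAdd n ⁻¹' X l) fun k => VASS.proj (d k) where
  zero := congrArg _ h.zero
  reach k hk := reach_proj (V.rb_step_eq_countStep ▸ h.reach k hk)
  state := h.state
  strict l hl _ hj := h.strict l hl _ hj
  nonstrict l hl _ hj hlt := h.nonstrict l hl _ hj hlt

end Modes

/-! ### Pumping the loops of a given chain. -/

section Pumping

variable {P : Type*} {n : ℕ} {W : VASS P n}

theorem above_freeze_iff {S : Set (Fin n)} {T : ℕ} {c z : Config P n} :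
    Above S T (freeze S c) z ↔ Above S T c z := by
  refine and_congr_right fun _ => and_congr_left fun _ => forall₂_congr fun j hj => ?_
  rw [freeze_of_notMem hj]

theorem reach_freeze {c c' : Config P n} (h : ReflTransGen W.Step c c') (S : Set (Fin n)) :
    ReflTransGen (W.FrozenStep S) (freeze S c) (freeze S c') :=
  h.lift (freeze S) fun _ _ h => h.freeze S

/-- Only components from earlier sets may decrease on a segment; freezing them turns the segment
into a nondecreasing loop. -/
theorem IsChain.freeze_le {c₀ : Config P n} {K : ℕ} {X : ℕ → Set (Fin n)} {d : ℕ → Config P n}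
    (h : W.IsChain c₀ K X d) {l : ℕ} (hl : l < K) :
    (freeze {j | ∃ l' < l, j ∈ X l'} (d (2 * l + 1))).2 ≤
      (freeze {j | ∃ l' < l, j ∈ X l'} (d (2 * l + 2))).2 := by
  intro j
  by_cases hj : j ∈ {j | ∃ l' < l, j ∈ X l'}
  · rw [freeze_of_mem hj, freeze_of_mem hj]
  · rw [freeze_of_notMem hj, freeze_of_notMem hj]
    by_cases hjl : j ∈ X l
    · exact (h.strict l hl j hjl).le
    · exact not_lt.1 fun hlt => hj (h.nonstrict l hl j hjl hlt)

/-- Pumping the first `l` loops of a chain makes all components in `X 0, …, X (l - 1)` large. -/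
theorem IsChain.exists_pumped {c₀ : Config P n} {K : ℕ} {X : ℕ → Set (Fin n)}
    {d : ℕ → Config P n} (h : W.IsChain c₀ K X d) {l : ℕ} (hl : l ≤ K) (T : ℕ) :
    ∃ z, ReflTransGen W.Step c₀ z ∧ Above {j | ∃ l' < l, j ∈ X l'} T (d (2 * l)) z := by
  induction l generalizing T with
  | zero => exact ⟨c₀, .refl, by simp [Above, h.zero]⟩
  | succ l ih =>
    have hab := reach_freeze (h.reach (2 * l + 1) (by omega)) {j | ∃ l' < l, j ∈ X l'}
    -- `T + 1` rather than `T`: even for `T = 0` one iteration is needed to dominate `d (2 * l +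
    -- 2)`.
    obtain ⟨T₁, h1⟩ := exists_lift_iterate hab (h.state l hl) (h.freeze_le hl) (T + 1) T
    obtain ⟨T₂, h2⟩ := exists_lift_reach
      (reach_freeze (h.reach (2 * l) (by omega)) {j | ∃ l' < l, j ∈ X l'}) T₁
    obtain ⟨z, hz, hz'⟩ := ih (Nat.le_of_succ_le hl) T₂
    obtain ⟨z₁, r1, m1, -⟩ := h2 z (above_freeze_iff.2 hz')
    obtain ⟨z₂, r2, m2, s2⟩ := h1 z₁ m1
    have key : ∀ j ∉ {j | ∃ l' < l, j ∈ X l'}, (d (2 * l + 2)).2 j ≤ z₂.2 j ∧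
        ((d (2 * l + 1)).2 j < (d (2 * l + 2)).2 j → T ≤ z₂.2 j) := fun j hj => by
      have h1 := m1.2.1 j hj
      have h2 := s2 j hj
      have h3 := h.freeze_le hl j
      rw [freeze_of_notMem hj] at h1
      rw [freeze_of_notMem hj, freeze_of_notMem hj] at h2 h3
      obtain ⟨e, he⟩ := Nat.exists_eq_add_of_le h3
      rw [he] at h2 ⊢
      have h4 : z₂.2 j = z₁.2 j + (T + 1) * e := by
        rw [Nat.mul_add] at h2
        omega
      have h5 : e ≤ (T + 1) * e := Nat.le_mul_of_pos_left e (Nat.succ_pos T)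
      refine ⟨by omega, fun hlt => ?_⟩
      have h6 : T + 1 ≤ (T + 1) * e := Nat.le_mul_of_pos_right _ (by omega)
      omega
    refine ⟨z₂, (hz.trans r1).trans r2, m2.1.trans (h.state l hl), fun j hj => ?_, fun j hj => ?_⟩
    · exact (key j fun ⟨l', hl', hj'⟩ => hj ⟨l', Nat.lt_succ_of_lt hl', hj'⟩).1
    · by_cases hjS : j ∈ {j | ∃ l' < l, j ∈ X l'}
      · exact m2.2.2 j hjS
      · obtain ⟨l', hl', hj'⟩ := hj
        rcases Nat.lt_succ_iff_lt_or_eq.1 hl' with hl' | rfl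
        · exact absurd ⟨l', hl', hj'⟩ hjS
        · exact (key j hjS).2 (h.strict _ hl j hj')

end Pumping

/-! ### The two directions of the equivalence. -/

section Main

variable {Q : Type*} {n : ℕ} {V : VASS Q n} {i : Fin n}

/-- A nondecreasing loop with a reversal of the frozen component `i` can be iterated so that every
iteration reverses `i` above `B`. -/
theorem exists_counted_iterate {S : Set (Fin n)} (hi : i ∈ S)
    {a u v b : Config (Q × (Fin n → Mode)) n}
    (hau : ReflTransGen (V.moded.FrozenStep S) a u) (huv : V.moded.FrozenStep S u v)
    (hrev : u.1.2 i ≠ v.1.2 i) (hvb : ReflTransGen (V.moded.FrozenStep S) v b)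
    (hst : a.1 = b.1) (hle : a.2 ≤ b.2) (B m : ℕ) :
    ∃ T, ∀ z, Above S T a (proj z) → ∃ z', ReflTransGen (V.CountStep fun x => B < x) z z' ∧
      z.2 (Fin.natAdd n i) + m ≤ z'.2 (Fin.natAdd n i) := by
  induction m with
  | zero => exact ⟨0, fun z _ => ⟨z, .refl, le_rfl⟩⟩
  | succ m ih =>
    obtain ⟨T₁, h1⟩ := ih
    obtain ⟨T₂, h2⟩ := exists_lift_reach hvb T₁
    obtain ⟨T₃, h3⟩ := huv.exists_lift T₂
    -- The bound `B + 1` puts the frozen component `i` above `B` just before the reversal.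
    obtain ⟨T₄, h4⟩ := exists_lift_reach hau (max T₃ (B + 1))
    refine ⟨T₄, fun z hz => ?_⟩
    obtain ⟨y₁, r1, m1, -⟩ := h4 _ hz
    obtain ⟨z₁, t1, rfl⟩ := exists_reach_countStep r1 fun x => B < x
    obtain ⟨y₂, r2, m2, -⟩ := h3 _ (m1.mono (le_max_left _ _) rfl le_rfl)
    obtain ⟨z₂, t2, rfl⟩ := r2.exists_countStep fun x => B < x
    obtain ⟨y₃, r3, m3, -⟩ := h2 _ m2
    obtain ⟨z₃, t3, rfl⟩ := exists_reach_countStep r3 fun x => B < x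
    obtain ⟨z₄, t4, hz₄⟩ := h1 z₃ (m3.mono le_rfl hst hle)
    refine ⟨z₄, ((t1.tail t2).trans t3).trans t4, ?_⟩
    have e1 := counter_le_of_reach t1 i
    have e3 := counter_le_of_reach t3 i
    have hs1 : z₁.1 = u.1 := m1.1
    have hs2 : z₂.1 = v.1 := m2.1
    have e2 := t2.counter_lt (j := i) (by rwa [hs1, hs2])
      ((le_max_right T₃ (B + 1)).trans (m1.2.2 i hi))
    omega

theorem not_weaklyReversalBoundedWrt_of_isChain {c : Config Q n} {K : ℕ}
    {X : ℕ → Set (Fin (n + n))} {d : ℕ → Config (Q × (Fin n → Mode)) (n + n)}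
    (h : V.rb.IsChain (rbInit c) (K + 1) X d) (hK : Fin.natAdd n i ∈ X K)
    (hi : ∃ l < K, Fin.castAdd n i ∈ X l) : ¬ V.WeaklyReversalBoundedWrt c i := by
  rintro ⟨B, hB⟩
  obtain ⟨M, hM⟩ := hB.bddAbove
  have hW := h.proj
  have hKK : K < K + 1 := Nat.lt_succ_self K
  have hloop := h.reach (2 * K + 1) (by omega)
  rw [rb_step_eq_countStep] at hloop
  obtain ⟨u, v, hau, huv, hrev, hvb⟩ := exists_mark_of_counter_lt hloop (h.strict K hKK _ hK)
  let S : Set (Fin n) := {j | ∃ l < K, j ∈ Fin.castAdd n ⁻¹' X l}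
  obtain ⟨T₁, h1⟩ := exists_counted_iterate (S := S) hi (reach_freeze hau S) (huv.freeze S) hrev
    (reach_freeze hvb S) (hW.state K hKK) (hW.freeze_le hKK) B (M + 1)
  obtain ⟨T₂, h2⟩ := exists_lift_reach (reach_freeze (hW.reach (2 * K) (by omega)) S) T₁
  obtain ⟨z, hz, hz'⟩ := hW.exists_pumped hKK.le T₂
  obtain ⟨z₁, r1, m1, -⟩ := h2 z (above_freeze_iff.2 hz')
  obtain ⟨y, hy, rfl⟩ := exists_reach_countStep (hz.trans r1) fun x => B < x
  obtain ⟨y', hy', hle⟩ := h1 y m1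
  have := hM ⟨y', V.tsStep_eq_countStep B ▸ hy.trans hy', rfl⟩
  omega

theorem exists_isChain_of_not_weaklyReversalBoundedWrt {c : Config Q n}
    (h : ¬ V.WeaklyReversalBoundedWrt c i) :
    ∃ K X d, V.rb.IsChain (rbInit c) (K + 1) X d ∧ (∀ l < K + 1, (X l).Nonempty) ∧
      (∀ l < K + 1, ∀ l' < l, Disjoint (X l') (X l)) ∧ Fin.natAdd n i ∈ X K ∧
      ∃ l < K, Fin.castAdd n i ∈ X l := by
  have hrich : V.moded.Rich (fun s t => s.2 i ≠ t.2 i) i ∅ (proj (rbInit c)) := fun N => by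
    have hinf := not_exists.1 h N
    obtain ⟨m, ⟨d, hd, rfl⟩, hN⟩ := Set.Infinite.exists_gt hinf N
    rw [tsStep_eq_countStep] at hd
    obtain ⟨L, m, hL, hm⟩ := exists_markedRun_of_reach hd i
    refine ⟨L, hL.mono le_rfl ?_⟩
    have h0 : (rbInit c).2 (Fin.natAdd n i) = 0 := by simp only [rbInit, Fin.append_right]
    omega
  obtain ⟨S, c', hacc, hi, a, u, v, b, hca, hau, huv, hrev, hvb, hst, hle⟩ :=
    hrich.exists_accelerated_loop .init
  -- The final loop is run only once, so no lower bound is needed at its end.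
  obtain ⟨T₁, h1⟩ := exists_lift_reach hvb 0
  obtain ⟨T₂, h2⟩ := huv.exists_lift T₁
  obtain ⟨T₃, h3⟩ := exists_lift_reach hau T₂
  obtain ⟨T₄, h4⟩ := exists_lift_reach hca T₃
  obtain ⟨K, X, d, hd, hX, hX', hS, hz, -⟩ := hacc.exists_chain T₄
  obtain ⟨e, he, hed⟩ := hd.exists_lift
  rw [← hed] at hz
  obtain ⟨y₁, r1, m1, -⟩ := h4 _ hz
  obtain ⟨z₁, t1, rfl⟩ := exists_reach_countStep r1 fun _ => True
  obtain ⟨y₂, r2, m2, s2⟩ := h3 _ m1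
  obtain ⟨z₂, t2, rfl⟩ := exists_reach_countStep r2 fun _ => True
  obtain ⟨y₃, r3, m3, s3⟩ := h2 _ m2
  obtain ⟨z₃, t3, rfl⟩ := r3.exists_countStep fun _ => True
  obtain ⟨y₄, r4, m4, s4⟩ := h1 _ m3
  obtain ⟨z₄, t4, rfl⟩ := exists_reach_countStep r4 fun _ => True
  have hr := (t2.tail t3).trans t4
  have hs2 : z₂.1 = u.1 := m2.1
  have hs3 : z₃.1 = v.1 := m3.1
  rw [← rb_step_eq_countStep] at t1
  -- The singleton suffices, since other components may increase freely. Components that decrease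
  -- are frozen, hence lie in earlier sets.
  obtain ⟨X', d', hd', e1, e2, -⟩ := he.snoc (Y := {Fin.natAdd n i}) t1
    (V.rb_step_eq_countStep ▸ hr) (m1.1.trans (hst.trans m4.1.symm)) (by
      rintro _ rfl
      have := counter_le_of_reach t2 i
      have := t3.counter_lt (j := i) (by rwa [hs2, hs3]) trivial
      have := counter_le_of_reach t4 i
      omega) (fun k => by
      refine Fin.addCases (fun j => ?_) (fun j => ?_) k
      · intro _ hlt
        by_cases hj : j ∈ S
        · obtain ⟨l, hl, hj⟩ := (hS j).1 hj
          exact ⟨l, hl, j, hj, rfl⟩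
        · have h2 := s2 j hj
          have h3 := s3 j hj
          have h4 := s4 j hj
          have h5 : a.2 j ≤ b.2 j := hle j
          simp only [proj] at h2 h3 h4
          omega
      · intro _ hlt
        exact absurd (counter_le_of_reach hr j) hlt.not_ge)
  refine ⟨K, X', d', hd', fun l hl => ?_, fun l hl l' hl' => ?_, by rw [e2]; rfl, ?_⟩
  · rcases Nat.lt_succ_iff_lt_or_eq.1 hl with hl | rfl
    · rw [e1 l hl]
      exact (hX l hl).image _
    · rw [e2]
      exact Set.singleton_nonempty _
  · rcases Nat.lt_succ_iff_lt_or_eq.1 hl with hl | rfl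
    · rw [e1 l hl, e1 l' (hl'.trans hl)]
      exact Set.disjoint_image_of_injective (Fin.castAdd_injective n n) (hX' l hl l' hl')
    · rw [e2, e1 l' hl', Set.disjoint_singleton_right]
      rintro ⟨j, -, hj⟩
      have := congrArg Fin.val hj
      simp only [Fin.val_castAdd, Fin.val_natAdd] at this
      omega
  · obtain ⟨l, hl, hil⟩ := (hS i).1 hi
    exact ⟨l, hl, by rw [e1 l hl]; exact ⟨i, hil, rfl⟩⟩

end Main

end VASS

theorem mainTheorem7 {Q : Type*} {n : ℕ} (V : VASS Q n) (q : Q) (x : Fin n → ℕ) (i : Fin n) :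
    ¬ V.WeaklyReversalBoundedWrt (q, x) i ↔
      ∃ (K : ℕ) (X : Fin (K + 1) → Set (Fin (n + n))),
        VASS.IsDisjointnessSeq X ∧
        Fin.natAdd n i ∈ X (Fin.last K) ∧
        (∃ l : Fin K, Fin.castAdd n i ∈ X l.castSucc) ∧
        ∃ (L : ℕ) (ρ : Fin (L + 1) → VASS.Config (Q × (Fin n → VASS.Mode)) (n + n)),
          ρ 0 = VASS.rbInit (q, x) ∧ V.rb.IsRun ρ ∧ VASS.SatisfiesPB X ρ := by
  constructor
  · intro h
    obtain ⟨K, X, d, hd, hne, hdis, hK, l, hl, hil⟩ :=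
      VASS.exists_isChain_of_not_weaklyReversalBoundedWrt h
    refine ⟨K, fun l => X l, ⟨Nat.succ_pos K, fun l => hne l l.2, fun l l' hll => ?_⟩, hK,
      ⟨⟨l, hl⟩, hil⟩, (VASS.exists_run_satisfiesPB_iff _ (K + 1) X).2 ⟨d, hd⟩⟩
    rcases lt_or_gt_of_ne (Fin.val_ne_of_ne hll) with hlt | hlt
    · exact hdis l' l'.2 l hlt
    · exact (hdis l l.2 l' hlt).symm
  · rintro ⟨K, X, -, hK, ⟨l, hil⟩, hρ⟩
    -- The sequence is extended to `ℕ` by empty sets to match the indexing of chains.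
    obtain ⟨Y, hY⟩ : ∃ Y : ℕ → Set (Fin (n + n)), ∀ l : Fin (K + 1), Y l = X l :=
      ⟨fun l => if h : l < K + 1 then X ⟨l, h⟩ else ∅, fun l => dif_pos l.2⟩
    obtain rfl : (fun l : Fin (K + 1) => Y l) = X := funext hY
    obtain ⟨d, hd⟩ := (VASS.exists_run_satisfiesPB_iff _ (K + 1) Y).1 hρ
    exact VASS.not_weaklyReversalBoundedWrt_of_isChain hd hK ⟨l, l.2, hil⟩
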